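/- Let $(\mathfrak r,\mathfrak p)$ be a finite local principal ring (a finite commutative ring with exactly one maximal ideal $\mathfrak p$, in which every ideal is principal). Let $q=\#(\mathfrak r/\mathfrak p)$, and let $v\ge 1$ be the length of $\mathfrak r$, that is, $\mathfrak p^{v-1}\neq(0)$ and $\mathfrak p^{v}=(0)$. Let $n,N,r\ge 0$ be integers, let $f_1,\dots,f_n\in\mathfrak r[t_1,\dots,t_N]$ be linearly independent over $\mathfrak r$, and let $V$ be the $\mathfrak r$-module they span, so that every $f\in V$ is uniquely $f=\sum_{i=1}^n c_i(f)f_i$ with $c_i(f)\in\mathfrak r$. Let $x_1,\dots,x_r\in\mathfrak r^N$ be distinct points. Let $A_1,\dots,A_n,B_1,\dots,B_r\subset\mathfrak r$ be nonempty (finite) subsets such that, in each of them, the difference of any two distinct elements is a unit of $\mathfrak r$. For $1\le j\le r$ let $1\le v_j\le v$. Let $\mathcal S$ be the set of all $f\in V$ such that (i) $c_i(f)\in A_i$ for all $1\le i\le n$, and (ii) for all $1\le j\le r$ there is $b\in B_j$ with $f(x_j)-b\in\mathfrak p^{v_j}$. For positive integers $a_1,\dots,a_n$ and an integer $M\le\sum_i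 a_i$, put $\mathfrak m(a_1,\dots,a_n;M)=1$ if $M<n$, and if $M\ge n$ let $\mathfrak m(a_1,\dots,a_n;M)$ be the minimum of $\prod_{i=1}^n y_i$ over all $(y_1,\dots,y_n)\in\mathbb Z^n$ with $1\le y_i\le a_i$ for all $i$ and $\sum_{i=1}^n y_i=M$. Then: (a) Either $\#\mathcal S=0$ or $$\#\mathcal S\ \ge\ \mathfrak m\Bigl(\#A_1,\dots,\#A_n;\ \sum_{i=1}^n\#A_i-\sum_{j=1}^r\bigl(q^{v_j}-\#B_j\bigr)\Bigr).$$ (b) If $0\in A_i$ for all $i$, $0\in B_j$ for all $j$, and $$\sum_{i=1}^n\#A_i-\sum_{j=1}^r\bigl(q^{v_j}-\#B_j\bigr)>n,$$ then $\mathcal S$ contains a nonzero $f$. -/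

import Mathlib

namespace FatInterpolation

/-- The quantity `𝔪(a₁, …, aₙ; N)`: it is `1` when `N < n`, and otherwise the least product
`y₁ ⋯ yₙ` over integer tuples with `1 ≤ yᵢ ≤ aᵢ` for all `i` and `y₁ + ⋯ + yₙ = N`.
(It is meant for `aᵢ ≥ 1` and `N ≤ a₁ + ⋯ + aₙ`, where such tuples exist once `n ≤ N`.
The second argument is an integer since the values it is applied to may be negative.) -/
noncomputable def minProd {n : ℕ} (a : Fin n → ℕ) (N : ℤ) : ℕ :=
  if N < (n : ℤ) then 1
  else sInf {P : ℕ | ∃ y : Fin n → ℕ, (∀ i, 1 ≤ y i ∧ y i ≤ a i) ∧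
    ∑ i, (y i : ℤ) = N ∧ P = ∏ i, y i}

/-- `x ∈ B (mod I)`: the element `x` is congruent modulo `I` to some element of `B`. -/
def MemMod {R : Type*} [CommRing R] (x : R) (B : Set R) (I : Ideal R) : Prop :=
  ∃ b ∈ B, x - b ∈ I

/-- Condition (F): nonempty, finite, and differences of distinct elements are units. -/
structure ConditionF {R : Type*} [CommRing R] (A : Set R) : Prop where
  nonempty : A.Nonempty
  finite : A.Finite
  isUnit_sub : ∀ x ∈ A, ∀ y ∈ A, x ≠ y → IsUnit (x - y)

/-- A local ring with maximal ideal `𝔭` has length `v` when `v` is a positive integer with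
`𝔭 ^ (v - 1) ≠ 0` and `𝔭 ^ v = 0`. -/
structure HasLength (R : Type*) [CommRing R] [IsLocalRing R] (v : ℕ) : Prop where
  pos : 0 < v
  pow_pred_ne : IsLocalRing.maximalIdeal R ^ (v - 1) ≠ ⊥
  pow_eq : IsLocalRing.maximalIdeal R ^ v = ⊥

/-- The set of all `g` in the span `V` of the linearly independent polynomials `f₁, …, fₙ` whose
coordinates satisfy `cᵢ(g) ∈ Aᵢ` for all `i`, and whose values satisfy
`g(xⱼ) ∈ Bⱼ (mod 𝔭 ^ vⱼ)` for all `j`, where `𝔭` is the maximal ideal. -/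
def solutionSet {R : Type*} [CommRing R] [IsLocalRing R] {n N r : ℕ}
    {f : Fin n → MvPolynomial (Fin N) R} (hf : LinearIndependent R f)
    (x : Fin r → Fin N → R) (A : Fin n → Set R) (B : Fin r → Set R) (vs : Fin r → ℕ) :
    Set (Submodule.span R (Set.range f)) :=
  {g | (∀ i, hf.repr g i ∈ A i) ∧
    ∀ j, MemMod (MvPolynomial.eval (x j) (g : MvPolynomial (Fin N) R)) (B j)
      (IsLocalRing.maximalIdeal R ^ vs j)}

end FatInterpolation

/-! In coordinates, the problem counts points of the grid `∏ A i` where linear forms fall in `B j`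
modulo `𝔭 ^ vs j`. `exists_isUnit_eval_iff` encodes each congruence as "`H j` takes a unit value",
with `deg (H j) ≤ q ^ vs j - #(B j)`. The solutions are then the points where `∏ j, H j` is a unit,
and an Alon–Füredi bound over the residue field counts these.

`H` is built by induction on the exponent. Let `T ⊇ B` represent all residue classes. On the grid `∏
s ∈ T, (P - s)` equals `ϖ * Q`, and exactly one factor is a nonunit, so `ϖ ^ v ∣ Q` iff `ϖ ^ (v +
1)` divides that factor. The recursive polynomial for `Q` and `{0}`, times `∏ s ∈ T \ B, (P - s)`,
is the new `H`. -/

namespace FatInterpolation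

open MvPolynomial Finset

/-! ### Polynomials on grids: reduction and the footprint bound. -/

section Grid

variable {R : Type*} [CommRing R]

/-- Every polynomial agrees on a grid with one of no larger total degree whose degree in each
variable is less than the corresponding side of the grid. -/
theorem exists_reduced [Nontrivial R] {n : ℕ} (S : Fin n → Finset R)
    (hS : ∀ i, (S i).Nonempty) (f : MvPolynomial (Fin n) R) :
    ∃ r : MvPolynomial (Fin n) R, r.totalDegree ≤ f.totalDegree ∧
      (∀ i, r.degreeOf i < #(S i)) ∧
      ∀ x : Fin n → R, (∀ i, x i ∈ S i) → eval x r = eval x f := by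
  have hmonic : ∀ i, MonomialOrder.degLex.Monic (∏ s ∈ S i, (X i - C s : MvPolynomial (Fin n) R)) :=
    fun i => MonomialOrder.Monic.prod fun s _ => MonomialOrder.degLex.monic_X_sub_C i s
  have hdeg : ∀ i, MonomialOrder.degLex.degree (∏ s ∈ S i, (X i - C s : MvPolynomial (Fin n) R))
      = Finsupp.single i #(S i) := by
    intro i
    rw [MonomialOrder.degree_prod_of_regular]
    · simp [Finset.sum_congr rfl (fun r _ ↦ MonomialOrder.degLex.degree_X_sub_C i r)]
    · intro r _
      rw [MonomialOrder.degLex.monic_X_sub_C]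
      exact isRegular_one
  -- The divisors vanish on the grid, so the remainder keeps the values of `f`; a graded order keeps
  -- the total degree from growing.
  obtain ⟨h, r, hf, hh, hr⟩ := MonomialOrder.degLex.div
    (b := fun i ↦ (∏ s ∈ S i, (X i - C s : MvPolynomial (Fin n) R)))
    (fun i ↦ by simp only [(hmonic i).leadingCoeff_eq_one, isUnit_one]) f
  have hr' : r = f - ∑ i ∈ h.support, h i * ∏ s ∈ S i, (X i - C s) := by
    rw [hf, Finsupp.linearCombination_apply, Finsupp.sum]
    simp
  refine ⟨r, ?_, ?_, ?_⟩
  · rw [hr']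
    refine (totalDegree_sub _ _).trans (max_le le_rfl ?_)
    refine totalDegree_finsetSum_le fun i _ => ?_
    rw [mul_comm]
    exact degLex_totalDegree_monotone (hh i)
  · intro i
    rw [degreeOf_eq_sup, Finset.sup_lt_iff (by simpa using (hS i).card_pos)]
    intro c hc
    have := hr c hc i
    rw [hdeg] at this
    simpa using this
  · intro x hx
    rw [hr', map_sub, map_sum, Finset.sum_eq_zero, sub_zero]
    intro i _
    rw [map_mul, _root_.map_prod, Finset.prod_eq_zero (hx i), mul_zero]
    simp

/-- A footprint bound for the number of nonzero values of a reduced polynomial on a grid. -/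
theorem exists_prod_le_card_eval_ne_zero [IsDomain R] [DecidableEq R] {n : ℕ} (S : Fin n → Finset R)
    (G : MvPolynomial (Fin n) R) (hG : G ≠ 0) (hdeg : ∀ i, G.degreeOf i < #(S i)) :
    ∃ e : Fin n → ℕ, (∀ i, e i < #(S i)) ∧ ∑ i, e i ≤ G.totalDegree ∧
      ∏ i, (#(S i) - e i) ≤ #{x ∈ Fintype.piFinset S | eval x G ≠ 0} := by
  induction n with
  | zero =>
    refine ⟨fun _ => 0, fun i => i.elim0, by simp, ?_⟩
    simp only [univ_eq_empty, prod_empty, Nat.one_le_iff_ne_zero, ← pos_iff_ne_zero, card_pos]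
    refine ⟨default, ?_⟩
    rw [mem_filter]
    refine ⟨by simp, fun h => hG ?_⟩
    rw [eq_C_of_isEmpty G] at h ⊢
    simpa using h
  | succ n ih =>
    -- Regard `G` as univariate in `X 0` and induct on its leading coefficient.
    set p := finSuccEquiv R n G with hp
    have hp0 : p ≠ 0 := by simpa [hp] using hG
    have hd : p.natDegree = G.degreeOf 0 := natDegree_finSuccEquiv G
    have hg : p.coeff p.natDegree ≠ 0 := by simpa using hp0
    obtain ⟨e, he, hsum, hcard⟩ := ih (fun i => S i.succ) (p.coeff p.natDegree) hg
      (fun i => (degreeOf_coeff_finSuccEquiv G i _).trans_lt (hdeg i.succ))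
    refine ⟨Fin.cons p.natDegree e, ?_, ?_, ?_⟩
    · intro i
      refine Fin.cases ?_ (fun j => ?_) i
      · simpa [hd] using hdeg 0
      · simpa using he j
    · rw [Fin.sum_univ_succ]
      simp only [Fin.cons_zero, Fin.cons_succ]
      have := totalDegree_coeff_finSuccEquiv_add_le G p.natDegree hg
      simp only [← hp] at this
      omega
    · rw [Fin.prod_univ_succ]
      simp only [Fin.cons_zero, Fin.cons_succ]
      set T := {x ∈ Fintype.piFinset (fun i : Fin n => S i.succ) |
        eval x (p.coeff p.natDegree) ≠ 0} with hT
      let U : (Fin n → R) → Finset R := fun x =>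
        {a ∈ S 0 | (p.map (eval x)).eval a ≠ 0}
      -- Where the leading coefficient survives, the specialized polynomial is nonzero and has at
      -- most `p.natDegree` roots.
      have hU : ∀ x ∈ T, #(S 0) - p.natDegree ≤ #(U x) := by
        intro x hx
        have hne : p.map (eval x) ≠ 0 := by
          intro h
          have h' := congrArg (fun w => Polynomial.coeff w p.natDegree) h
          simp only [Polynomial.coeff_map, Polynomial.coeff_zero] at h'
          exact (mem_filter.1 hx).2 h'
        have h1 := Finset.card_filter_add_card_filter_not (s := S 0)
          (fun a => (p.map (eval x)).eval a ≠ 0)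
        have h2 : #{a ∈ S 0 | ¬ (p.map (eval x)).eval a ≠ 0} ≤ p.natDegree := by
          refine le_trans ?_ ((Polynomial.card_roots' (p.map (eval x))).trans
            Polynomial.natDegree_map_le)
          refine le_trans (card_le_card ?_) (Multiset.toFinset_card_le _)
          intro a ha
          simpa [hne] using (mem_filter.1 ha).2
        simp only [U]
        omega
      calc (#(S 0) - p.natDegree) * ∏ i, (#(S i.succ) - e i)
          ≤ (#(S 0) - p.natDegree) * #T := Nat.mul_le_mul_left _ hcard
        _ = ∑ x ∈ T, (#(S 0) - p.natDegree) := by rw [sum_const, smul_eq_mul, mul_comm]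
        _ ≤ ∑ x ∈ T, #(U x) := sum_le_sum hU
        _ = #(T.sigma U) := (card_sigma _ _).symm
        _ ≤ _ := by
          refine card_le_card_of_injOn (fun z => Fin.cons z.2 z.1) ?_ ?_
          · rintro ⟨x, a⟩ hz
            simp only [coe_sigma, Set.mem_sigma_iff, mem_coe, hT, U, mem_filter,
              Fintype.mem_piFinset] at hz
            simp only [mem_coe, mem_filter, Fintype.mem_piFinset]
            refine ⟨fun i => ?_, ?_⟩
            · refine Fin.cases ?_ (fun j => ?_) i
              · simpa using hz.2.1
              · simpa using hz.1.1 j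
            · rw [eval_eq_eval_mv_eval']
              exact hz.2.2
          · rintro ⟨x, a⟩ _ ⟨x', a'⟩ _ h
            obtain ⟨h1, h2⟩ := Fin.cons_inj.1 h
            subst h1 h2
            rfl

theorem degreeOf_map_le {S σ : Type*} [CommRing S] (φ : R →+* S) (P : MvPolynomial σ R) (i : σ) :
    (P.map φ).degreeOf i ≤ P.degreeOf i := by
  classical
  rw [degreeOf_eq_sup, degreeOf_eq_sup]
  exact sup_mono (support_map_subset φ P)

end Grid

/-! ### Unit values and congruences over a local ring. -/

section LocalRing

variable {R : Type*} [CommRing R] [IsLocalRing R]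

open IsLocalRing

/-- Condition (F) enters the counting through this: such sets lose no elements in the residue field.
-/
theorem ConditionF.injOn_residue {A : Set R} (hA : ConditionF A) : Set.InjOn (residue R) A := by
  intro x hx y hy h
  by_contra hne
  have := hA.isUnit_sub x hx y hy hne
  rw [← isUnit_map_iff (residue R), map_sub, h, sub_self] at this
  exact not_isUnit_zero this

theorem isUnit_iff_residue_ne_zero {a : R} : IsUnit a ↔ residue R a ≠ 0 := by
  rw [← isUnit_map_iff (residue R), isUnit_iff_ne_zero]

theorem eval_map_residue {σ : Type*} (x : σ → R) (P : MvPolynomial σ R) :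
    eval (fun i => residue R (x i)) (P.map (residue R)) = residue R (eval x P) := by
  rw [eval_map]
  exact (eval₂_comp (residue R) x P).symm

/-- An Alon–Füredi bound for the number of unit values on a grid over a local ring. -/
theorem exists_prod_le_card_isUnit_eval [DecidableEq R] {n : ℕ} (S : Fin n → Finset R)
    (hS : ∀ i, Set.InjOn (residue R) (S i)) (G : MvPolynomial (Fin n) R)
    (x₀ : Fin n → R) (hx₀ : ∀ i, x₀ i ∈ S i) (hunit : IsUnit (eval x₀ G)) :
    ∃ y : Fin n → ℕ, (∀ i, 1 ≤ y i ∧ y i ≤ #(S i)) ∧ ∑ i, #(S i) ≤ ∑ i, y i + G.totalDegree ∧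
      ∏ i, y i ≤ {x | (∀ i, x i ∈ S i) ∧ IsUnit (eval x G)}.ncard := by
  classical
  obtain ⟨r, hrG, hrS, hr⟩ := exists_reduced S (fun i => ⟨_, hx₀ i⟩) G
  have hcard : ∀ i, #((S i).image (residue R)) = #(S i) := fun i => card_image_of_injOn (hS i)
  -- The unit value at `x₀` keeps the reduced polynomial nonzero over the residue field.
  obtain ⟨e, he, hsum, hprod⟩ := exists_prod_le_card_eval_ne_zero
    (fun i => (S i).image (residue R)) (r.map (residue R))
    (by
      intro h
      have := eval_map_residue x₀ r
      rw [h, map_zero, hr _ hx₀] at this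
      exact isUnit_iff_residue_ne_zero.1 hunit this.symm)
    (fun i => by
      rw [hcard]
      exact (degreeOf_map_le _ _ i).trans_lt (hrS i))
  simp only [hcard] at he hprod
  refine ⟨fun i => #(S i) - e i, fun i => ⟨Nat.sub_pos_of_lt (he i), by simp⟩, ?_, ?_⟩
  · have h1 : ∑ i, #(S i) = ∑ i, (#(S i) - e i) + ∑ i, e i := by
      rw [← sum_add_distrib]
      exact sum_congr rfl fun i _ => by have := he i; omega
    rw [h1]
    have h2 : (r.map (residue R)).totalDegree ≤ r.totalDegree :=
      sup_mono (support_map_subset (residue R) r)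
    exact add_le_add_right (hsum.trans (h2.trans hrG)) _
  · refine hprod.trans ?_
    have hfin : {x | (∀ i, x i ∈ S i) ∧ IsUnit (eval x G)}
        = (({x ∈ Fintype.piFinset S | IsUnit (eval x G)} : Finset _) : Set (Fin n → R)) := by
      ext x
      simp
    rw [hfin, Set.ncard_coe_finset]
    refine le_trans (card_le_card ?_) (card_image_le (f := fun x i => residue R (x i)))
    intro z hz
    simp only [mem_filter, Fintype.mem_piFinset, mem_image] at hz ⊢
    choose x hx hxz using hz.1
    refine ⟨x, ⟨hx, ?_⟩, funext hxz⟩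
    rw [isUnit_iff_residue_ne_zero, ← hr x hx, ← eval_map_residue, funext hxz]
    exact hz.2

/-- A polynomial with values in `(ϖ)` on a grid can be divided by `ϖ` there. -/
theorem exists_eval_eq_mul_eval {n : ℕ} (S : Fin n → Finset R) (hne : ∀ i, (S i).Nonempty)
    (hS : ∀ i, Set.InjOn (residue R) (S i)) {ϖ : R} (hϖ : maximalIdeal R = Ideal.span {ϖ})
    (P : MvPolynomial (Fin n) R)
    (hP : ∀ x : Fin n → R, (∀ i, x i ∈ S i) → ϖ ∣ eval x P) :
    ∃ Q : MvPolynomial (Fin n) R, Q.totalDegree ≤ P.totalDegree ∧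
      ∀ x : Fin n → R, (∀ i, x i ∈ S i) → eval x P = ϖ * eval x Q := by
  classical
  obtain ⟨r, hrP, hrS, hr⟩ := exists_reduced S hne P
  have hres : ∀ a : R, residue R a = 0 ↔ ϖ ∣ a := by
    intro a
    rw [residue_eq_zero_iff, hϖ, Ideal.mem_span_singleton]
  -- Modulo `ϖ`, the reduced polynomial vanishes on a grid too large for its degrees, so `ϖ` divides
  -- every coefficient.
  have hmap : r.map (residue R) = 0 := by
    refine eq_zero_of_eval_zero_at_prod_finset _ (fun i => (S i).image (residue R)) ?_ ?_
    · intro i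
      rw [card_image_of_injOn (hS i)]
      exact (degreeOf_map_le _ _ i).trans_lt (hrS i)
    · intro z hz
      simp only [mem_image] at hz
      choose x hx hxz using hz
      rw [← funext hxz, eval_map_residue, hr x hx, hres]
      exact hP x hx
  have hcoeff : ∀ m, ϖ ∣ r.coeff m := by
    intro m
    rw [← hres, ← coeff_map, hmap, coeff_zero]
  choose c hc using hcoeff
  refine ⟨∑ m ∈ r.support, monomial m (c m), ?_, ?_⟩
  · refine le_trans (totalDegree_finsetSum_le fun m hm => ?_) hrP
    exact (totalDegree_monomial_le _ _).trans (le_totalDegree hm)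
  · intro x hx
    rw [← hr x hx, ← eval_C (f := x) ϖ, ← map_mul, mul_sum]
    congr 1
    conv_lhs => rw [r.as_sum]
    refine sum_congr rfl fun m _ => ?_
    rw [C_mul_monomial, ← hc]

/-- Cancelling `ϖ` despite zero divisors: if `a` were a unit times a lower power `ϖ ^ k`, the
hypothesis would force `ϖ ^ (k + 1) = 0` with `k + 1 ≤ m`. -/
theorem pow_dvd_of_pow_succ_dvd_mul {ϖ : R} (hϖ : maximalIdeal R = Ideal.span {ϖ}) {m : ℕ}
    (hm : ϖ ^ m ≠ 0) {a : R} (h : ϖ ^ (m + 1) ∣ ϖ * a) : ϖ ^ m ∣ a := by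
  induction m with
  | zero => simp
  | succ m ih =>
    obtain ⟨b, rfl⟩ := ih (fun h0 => hm (by rw [pow_succ, h0, zero_mul]))
      ((pow_dvd_pow _ (Nat.le_succ _)).trans h)
    obtain ⟨z, hz⟩ := h
    have hnu : ¬ IsUnit b := by
      intro hb
      have hmem : ϖ * z ∈ maximalIdeal R := by
        rw [hϖ]
        exact Ideal.mem_span_singleton.2 (dvd_mul_right _ _)
      have hu : IsUnit (b - ϖ * z) := by
        rw [isUnit_iff_residue_ne_zero] at hb ⊢
        rwa [map_sub, (residue_eq_zero_iff _).2 hmem, sub_zero]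
      refine hm (hu.mul_left_eq_zero.1 ?_)
      linear_combination hz
    have : b ∈ maximalIdeal R := hnu
    rw [hϖ, Ideal.mem_span_singleton] at this
    rw [pow_succ]
    exact mul_dvd_mul_left _ this

/-- Over a local ring with principal maximal ideal `(ϖ)` and residue field of order `q`, membership
of the values of `P` in `B` modulo `ϖ ^ v` is detected, on a grid, by the unit values of a
polynomial of degree at most `deg P * (q ^ v - #B)`. -/
theorem exists_isUnit_eval_iff [DecidableEq R] [Finite (ResidueField R)] {n : ℕ}
    (S : Fin n → Finset R) (hne : ∀ i, (S i).Nonempty)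
    (hS : ∀ i, Set.InjOn (residue R) (S i)) {ϖ : R} (hϖ : maximalIdeal R = Ideal.span {ϖ})
    (v : ℕ) (hv : ∀ m < v, ϖ ^ m ≠ 0) (P : MvPolynomial (Fin n) R) (B : Finset R)
    (hBne : B.Nonempty) (hB : Set.InjOn (residue R) B) :
    ∃ H : MvPolynomial (Fin n) R,
      H.totalDegree ≤ P.totalDegree * (Nat.card (ResidueField R) ^ v - #B) ∧
      ∀ x : Fin n → R, (∀ i, x i ∈ S i) →
        (IsUnit (eval x H) ↔ ∃ b ∈ B, ϖ ^ v ∣ eval x P - b) := by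
  induction v generalizing P B with
  | zero =>
    refine ⟨1, by simp, fun x _ => ?_⟩
    obtain ⟨b, hb⟩ := hBne
    simpa using ⟨b, hb⟩
  | succ v ih =>
    have hres : ∀ a : R, residue R a = 0 ↔ ϖ ∣ a := by
      intro a
      rw [residue_eq_zero_iff, hϖ, Ideal.mem_span_singleton]
    -- Extend `B` to a complete system of residue representatives.
    obtain ⟨T', hBT', -, hT'⟩ := hB.bijOn_image.exists_extend_of_subset
      (s₁ := Set.univ) (t' := Set.univ) (Set.subset_univ _) (Set.subset_univ _)
      (fun z _ => by simpa using residue_surjective z)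
    have hTfin : T'.Finite := hT'.finite_iff_finite.2 Set.finite_univ
    obtain ⟨T, rfl⟩ := hTfin.exists_finset_coe
    have hTcard : #T = Nat.card (ResidueField R) := by
      rw [← Nat.card_univ, ← Set.ncard_coe_finset, ← Nat.card_coe_set_eq]
      exact Nat.card_congr (hT'.equiv _)
    have hBT : B ⊆ T := coe_subset.1 hBT'
    have hTrep : ∀ a : R, ∃ s ∈ T, ϖ ∣ a - s := by
      intro a
      obtain ⟨s, hs, hsa⟩ := hT'.surjOn (Set.mem_univ (residue R a))
      exact ⟨s, hs, by rw [← hres, map_sub, hsa, sub_self]⟩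
    have hTunit : ∀ a : R, ∀ s ∈ T, ∀ t ∈ T, ϖ ∣ a - s → t ≠ s → IsUnit (a - t) := by
      intro a s hs t ht has hts
      rw [isUnit_iff_residue_ne_zero, map_sub, sub_ne_zero]
      rw [← hres, map_sub, sub_eq_zero] at has
      rw [has]
      exact fun h => hts (hT'.injOn ht hs h.symm)
    have hprod : ∀ (W : Finset R) (x : Fin n → R),
        eval x (∏ s ∈ W, (P - C s)) = ∏ s ∈ W, (eval x P - s) := by
      intro W x
      simp [_root_.map_prod]
    have hdeg : ∀ W : Finset R, (∏ s ∈ W, (P - C s)).totalDegree ≤ #W * P.totalDegree := by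
      intro W
      refine (totalDegree_finsetProd _ _).trans ?_
      rw [← smul_eq_mul]
      exact sum_le_card_nsmul _ _ _ fun s _ => totalDegree_sub_C_le P s
    obtain ⟨Q, hQdeg, hQ⟩ := exists_eval_eq_mul_eval S hne hS hϖ (∏ s ∈ T, (P - C s)) (by
      intro x _
      obtain ⟨s, hs, hd⟩ := hTrep (eval x P)
      rw [hprod]
      exact hd.trans (dvd_prod_of_mem _ hs))
    obtain ⟨H, hHdeg, hH⟩ := ih (fun m hm => hv m (by omega)) Q {0} (by simp) (by simp)
    -- The first factor is a unit iff the residue of `P` comes from `B`; `H` then tests the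
    -- higher-order congruence.
    refine ⟨(∏ s ∈ T \ B, (P - C s)) * H, ?_, ?_⟩
    · set q := Nat.card (ResidueField R) with hq
      have hBq : #B ≤ q := hTcard ▸ card_le_card hBT
      have hq1 : 1 ≤ q := (card_pos.2 hBne).trans_le hBq
      have hqv : 1 ≤ q ^ v := Nat.one_le_pow _ _ hq1
      have h1 := hdeg (T \ B)
      rw [card_sdiff_of_subset hBT, hTcard] at h1
      have h2 : H.totalDegree ≤ q * P.totalDegree * (q ^ v - 1) := by
        refine hHdeg.trans ?_
        rw [card_singleton, ← hTcard]
        exact Nat.mul_le_mul_right _ (hQdeg.trans (hdeg T))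
      have h3 : q ^ (v + 1) - #B = (q - #B) + q * (q ^ v - 1) := by
        zify [hBq, hqv, hBq.trans (Nat.le_self_pow (Nat.succ_ne_zero v) q)]
        ring
      calc _ ≤ _ := totalDegree_mul _ _
        _ ≤ (q - #B) * P.totalDegree + q * P.totalDegree * (q ^ v - 1) := add_le_add h1 h2
        _ = _ := by rw [h3]; ring
    · intro x hx
      have hQx := hQ x hx
      rw [hprod] at hQx
      rw [map_mul, IsUnit.mul_iff, hH x hx, hprod, IsUnit.prod_iff]
      simp only [mem_singleton, exists_eq_left, sub_zero, mem_sdiff, and_imp]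
      have hfactor : ∀ s ∈ T, ϖ ∣ eval x P - s →
          (ϖ ^ v ∣ eval x Q ↔ ϖ ^ (v + 1) ∣ eval x P - s) := by
        intro s hs hd
        -- Up to this unit, `eval x P - s` is `ϖ * eval x Q`.
        have hu : IsUnit (∏ t ∈ T.erase s, (eval x P - t)) := by
          rw [IsUnit.prod_iff]
          intro t ht
          exact hTunit _ s hs t (mem_of_mem_erase ht) hd (ne_of_mem_erase ht)
        rw [← mul_prod_erase _ _ hs] at hQx
        rw [← hu.dvd_mul_right (a := ϖ ^ (v + 1)), hQx]
        refine ⟨fun h => ?_, pow_dvd_of_pow_succ_dvd_mul hϖ (hv v (Nat.lt_succ_self v))⟩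
        rw [pow_succ']
        exact mul_dvd_mul_left _ h
      constructor
      · rintro ⟨hunit, hQv⟩
        obtain ⟨s, hs, hd⟩ := hTrep (eval x P)
        refine ⟨s, ?_, (hfactor s hs hd).1 hQv⟩
        by_contra hsB
        exact isUnit_iff_residue_ne_zero.1 (hunit s hs hsB) ((hres _).2 hd)
      · rintro ⟨b, hb, hd⟩
        have hd1 : ϖ ∣ eval x P - b := (dvd_pow_self _ (Nat.succ_ne_zero v)).trans hd
        refine ⟨fun s hs hsB => hTunit _ b (hBT hb) s hs hd1 fun h => hsB (h ▸ hb),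
          (hfactor b (hBT hb) hd1).2 hd⟩

end LocalRing

/-! ### Properties of the minimal product. -/

section MinProd

/-- Lower an entry exceeding `1` by one until the sum is `m`; `n ≤ m` guarantees such an entry while
the sum is still larger. -/
theorem exists_le_sum_eq {n : ℕ} (y : Fin n → ℕ) (hy : ∀ i, 1 ≤ y i) (m : ℕ) (hn : n ≤ m)
    (hm : m ≤ ∑ i, y i) : ∃ z : Fin n → ℕ, (∀ i, 1 ≤ z i ∧ z i ≤ y i) ∧ ∑ i, z i = m := by
  induction h : ∑ i, y i - m generalizing y with
  | zero => exact ⟨y, fun i => ⟨hy i, le_rfl⟩, by omega⟩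
  | succ d ih =>
    obtain ⟨i, hi⟩ : ∃ i, 1 < y i := by
      by_contra! hle
      have : ∑ i, y i ≤ _ := sum_le_card_nsmul univ y 1 fun i _ => hle i
      simp only [card_univ, Fintype.card_fin, smul_eq_mul, mul_one] at this
      omega
    have hs : ∑ j, Function.update y i (y i - 1) j + 1 = ∑ j, y j := by
      rw [sum_update_of_mem (mem_univ i), ← add_sum_erase _ _ (mem_univ i), sdiff_singleton_eq_erase]
      omega
    obtain ⟨z, hz, hzm⟩ := ih (Function.update y i (y i - 1))
      (fun j => by
        by_cases hj : j = i
        · subst hj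
          simp only [Function.update_self]
          omega
        · simpa [hj] using hy j) (by omega) (by omega)
    refine ⟨z, fun j => ⟨(hz j).1, (hz j).2.trans ?_⟩, hzm⟩
    by_cases hj : j = i
    · subst hj
      simp
    · simp [hj]

/-- The Alon–Füredi tuple has its sum bounded only from below; shrinking it to the exact sum can
only decrease the product. -/
theorem minProd_le_prod {n : ℕ} {a y : Fin n → ℕ} (hy : ∀ i, 1 ≤ y i ∧ y i ≤ a i) {M : ℤ}
    (hM : M ≤ ∑ i, (y i : ℤ)) : minProd a M ≤ ∏ i, y i := by
  unfold minProd
  split_ifs with h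
  · exact Nat.one_le_iff_ne_zero.2 (prod_ne_zero_iff.2 fun i _ => by have := (hy i).1; omega)
  · lift M to ℕ using by omega
    obtain ⟨z, hz, hzm⟩ := exists_le_sum_eq y (fun i => (hy i).1) M (by omega) (by exact_mod_cast hM)
    refine le_trans (Nat.sInf_le ⟨z, fun i => ⟨(hz i).1, (hz i).2.trans (hy i).2⟩,
      by exact_mod_cast hzm, rfl⟩) ?_
    exact prod_le_prod' fun i _ => (hz i).2

/-- A sum above `n` forces an entry at least `2`. The bound `hM` makes the set of products nonempty,
excluding the default `sInf ∅ = 0`. -/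
theorem one_lt_minProd {n : ℕ} {a : Fin n → ℕ} (ha : ∀ i, 1 ≤ a i) {M : ℤ} (hn : (n : ℤ) < M)
    (hM : M ≤ ∑ i, (a i : ℤ)) : 1 < minProd a M := by
  unfold minProd
  rw [if_neg (by omega)]
  lift M to ℕ using by omega
  obtain ⟨z, hz, hzm⟩ := exists_le_sum_eq a ha M (by omega) (by exact_mod_cast hM)
  obtain ⟨y, hy, hyM, hP⟩ := Nat.sInf_mem (s := {P : ℕ | ∃ y : Fin n → ℕ,
    (∀ i, 1 ≤ y i ∧ y i ≤ a i) ∧ ∑ i, (y i : ℤ) = M ∧ P = ∏ i, y i})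
    ⟨_, z, fun i => hz i, by exact_mod_cast hzm, rfl⟩
  rw [hP]
  obtain ⟨i, hi⟩ : ∃ i, 1 < y i := by
    by_contra! hle
    have : ∑ i, y i ≤ _ := sum_le_card_nsmul univ y 1 fun i _ => hle i
    simp only [card_univ, Fintype.card_fin, smul_eq_mul, mul_one] at this
    have hyM' : ∑ i, y i = M := by exact_mod_cast hyM
    omega
  exact hi.trans_le (single_le_prod' (f := y) (fun j _ => (hy j).1) (mem_univ i))

end MinProd

/-! ### Passage to coordinates and the lower bound. -/

section Main

open IsLocalRing

variable {R : Type*} [CommRing R] [IsLocalRing R]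

theorem ConditionF.ncard_le_pow [Finite (ResidueField R)] {B : Set R} (hB : ConditionF B) {m : ℕ}
    (hm : 1 ≤ m) : B.ncard ≤ Nat.card (ResidueField R) ^ m := by
  rw [← hB.injOn_residue.ncard_image]
  exact (Set.ncard_le_card _).trans (Nat.le_self_pow (by omega) _)

theorem ncard_solutionSet {n N r : ℕ}
    {f : Fin n → MvPolynomial (Fin N) R} (hf : LinearIndependent R f)
    (x : Fin r → Fin N → R) (A : Fin n → Set R) (B : Fin r → Set R) (vs : Fin r → ℕ) :
    (solutionSet hf x A B vs).ncard =
      {c : Fin n → R | (∀ i, c i ∈ A i) ∧ ∀ j, MemMod (∑ i, c i * eval (x j) (f i)) (B j)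
        (maximalIdeal R ^ vs j)}.ncard := by
  have hinj : Function.Injective fun (g : Submodule.span R (Set.range f)) i => hf.repr g i := by
    intro g h hgh
    exact hf.linearCombinationEquiv.symm.injective (Finsupp.ext fun i => congrFun hgh i)
  have hval : ∀ (g : Submodule.span R (Set.range f)) (y : Fin N → R),
      eval y (g : MvPolynomial (Fin N) R) = ∑ i, hf.repr g i * eval y (f i) := by
    intro g y
    conv_lhs => rw [← hf.linearCombination_repr g]
    rw [Finsupp.linearCombination_apply, Finsupp.sum_fintype _ _ (by simp), map_sum]
    simp
  have hrepr : ∀ l, hf.repr (hf.linearCombinationEquiv l) = l :=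
    hf.linearCombinationEquiv.symm_apply_apply
  rw [← Set.ncard_image_of_injective _ hinj]
  congr 1
  ext c
  simp only [Set.mem_image, solutionSet, Set.mem_ofPred_eq, hval]
  constructor
  · rintro ⟨g, hg, rfl⟩
    exact hg
  · intro hc
    refine ⟨hf.linearCombinationEquiv (Finsupp.equivFunOnFinite.symm c), ?_, ?_⟩ <;>
      simp only [hrepr]
    · exact hc
    · rfl

/-- The lower bound for the number of points of a grid at which a system of linear forms takes
values in prescribed sets modulo powers of the maximal ideal. -/
theorem minProd_le_ncard_of_mem [IsPrincipalIdealRing R] [Finite R] {v : ℕ} (hv : HasLength R v)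
    {n r : ℕ} (u : Fin r → Fin n → R) (A : Fin n → Set R) (hA : ∀ i, ConditionF (A i))
    (B : Fin r → Set R) (hB : ∀ j, ConditionF (B j)) (vs : Fin r → ℕ)
    (hvs : ∀ j, 1 ≤ vs j ∧ vs j ≤ v) {c₀ : Fin n → R}
    (hc₀ : c₀ ∈ {c : Fin n → R | (∀ i, c i ∈ A i) ∧ ∀ j, MemMod (∑ i, c i * u j i) (B j)
        (maximalIdeal R ^ vs j)}) :
    minProd (fun i => (A i).ncard) (∑ i, ((A i).ncard : ℤ) -
      ∑ j, ((Nat.card (ResidueField R) : ℤ) ^ vs j - ((B j).ncard : ℤ))) ≤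
      {c : Fin n → R | (∀ i, c i ∈ A i) ∧ ∀ j, MemMod (∑ i, c i * u j i) (B j)
        (maximalIdeal R ^ vs j)}.ncard := by
  classical
  have : Finite (ResidueField R) := Finite.of_surjective _ (residue_surjective (R := R))
  obtain ⟨ϖ, hϖ⟩ := (IsPrincipalIdealRing.principal (maximalIdeal R)).principal
  replace hϖ : maximalIdeal R = Ideal.span {ϖ} := hϖ
  have hpow : ∀ m < v, ϖ ^ m ≠ 0 := by
    intro m hm h
    apply hv.pow_pred_ne
    rw [hϖ, Ideal.span_singleton_pow, Ideal.span_singleton_eq_bot]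
    exact pow_eq_zero_of_le (by omega) h
  let S : Fin n → Finset R := fun i => (hA i).finite.toFinset
  let T : Fin r → Finset R := fun j => (hB j).finite.toFinset
  have hSA : ∀ i, (S i : Set R) = A i := fun i => (hA i).finite.coe_toFinset
  have hTB : ∀ j, (T j : Set R) = B j := fun j => (hB j).finite.coe_toFinset
  have hS : ∀ i, Set.InjOn (residue R) (S i) := fun i => hSA i ▸ (hA i).injOn_residue
  have hT : ∀ j, Set.InjOn (residue R) (T j) := fun j => hTB j ▸ (hB j).injOn_residue
  have hmS : ∀ i a, a ∈ S i ↔ a ∈ A i := fun i a => by simp [S]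
  have hmT : ∀ j b, b ∈ T j ↔ b ∈ B j := fun j b => by simp [T]
  have hcS : ∀ i, #(S i) = (A i).ncard := fun i => by rw [← hSA, Set.ncard_coe_finset]
  have hcT : ∀ j, #(T j) = (B j).ncard := fun j => by rw [← hTB, Set.ncard_coe_finset]
  have hTq : ∀ j, #(T j) ≤ Nat.card (ResidueField R) ^ vs j := fun j =>
    (hcT j).trans_le ((hB j).ncard_le_pow (hvs j).1)
  -- Evaluation at `x j` is a linear form in the coordinates, so its degree contributes a factor at
  -- most `1`.
  choose H hHdeg hH using fun j => exists_isUnit_eval_iff S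
    (fun i => by simpa [S] using (hA i).nonempty) hS hϖ (vs j)
    (fun m hm => hpow m (hm.trans_le (hvs j).2)) (∑ i, C (u j i) * X i) (T j)
    (by simpa [T] using (hB j).nonempty) (hT j)
  have hset : {c : Fin n → R | (∀ i, c i ∈ A i) ∧ ∀ j, MemMod (∑ i, c i * u j i) (B j)
        (maximalIdeal R ^ vs j)} = {c | (∀ i, c i ∈ S i) ∧ IsUnit (eval c (∏ j, H j))} := by
    ext c
    simp only [Set.mem_ofPred_eq, hmS]
    refine and_congr_right fun hc => ?_
    rw [_root_.map_prod, IsUnit.prod_iff]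
    simp only [mem_univ, true_imp_iff, hH _ c fun i => (hmS i _).2 (hc i), hmT, MemMod, hϖ,
      Ideal.span_singleton_pow, Ideal.mem_span_singleton]
    simp [mul_comm]
  rw [hset] at hc₀ ⊢
  obtain ⟨y, hy, hsum, hprod⟩ := exists_prod_le_card_isUnit_eval S hS _ c₀ hc₀.1 hc₀.2
  simp only [hcS] at hy hsum
  refine le_trans (minProd_le_prod hy ?_) hprod
  have hlin : ∀ j, (∑ i, C (u j i) * X i : MvPolynomial (Fin n) R).totalDegree ≤ 1 := by
    intro j
    refine totalDegree_finsetSum_le fun i _ => ?_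
    refine (totalDegree_mul _ _).trans ?_
    simp
  have hdeg : (∏ j, H j).totalDegree ≤ ∑ j, (Nat.card (ResidueField R) ^ vs j - #(T j)) := by
    refine (totalDegree_finsetProd _ _).trans (sum_le_sum fun j _ => (hHdeg j).trans ?_)
    exact (Nat.mul_le_mul_right _ (hlin j)).trans (one_mul _).le
  -- Truncated subtraction is exact here because `#(T j) ≤ q ^ vs j`.
  have hcast : ∑ j, ((Nat.card (ResidueField R) : ℤ) ^ vs j - ((B j).ncard : ℤ)) =
      ((∑ j, (Nat.card (ResidueField R) ^ vs j - #(T j)) : ℕ) : ℤ) := by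
    rw [Nat.cast_sum]
    refine sum_congr rfl fun j _ => ?_
    rw [Nat.cast_sub (hTq j), hcT]
    push_cast
    rfl
  rw [hcast, sub_le_iff_le_add]
  exact_mod_cast hsum.trans (add_le_add_right hdeg _)

end Main

end FatInterpolation

theorem theorem3p16 {R : Type*} [CommRing R] [IsLocalRing R] [IsPrincipalIdealRing R] [Finite R]
    (q : ℕ) (hq : Nat.card (IsLocalRing.ResidueField R) = q)
    (v : ℕ) (hv : FatInterpolation.HasLength R v)
    (n N r : ℕ) (f : Fin n → MvPolynomial (Fin N) R) (hf : LinearIndependent R f)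
    (x : Fin r → Fin N → R) (hx : Function.Injective x)
    (A : Fin n → Set R) (hA : ∀ i, FatInterpolation.ConditionF (A i))
    (B : Fin r → Set R) (hB : ∀ j, FatInterpolation.ConditionF (B j))
    (vs : Fin r → ℕ) (hvs : ∀ j, 1 ≤ vs j ∧ vs j ≤ v) :
    ((FatInterpolation.solutionSet hf x A B vs).ncard = 0 ∨
      FatInterpolation.minProd (fun i => (A i).ncard)
        (∑ i, ((A i).ncard : ℤ) - ∑ j, ((q : ℤ) ^ vs j - ((B j).ncard : ℤ)))
          ≤ (FatInterpolation.solutionSet hf x A B vs).ncard) ∧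
    ((∀ i, (0 : R) ∈ A i) → (∀ j, (0 : R) ∈ B j) →
      (n : ℤ) < ∑ i, ((A i).ncard : ℤ) - ∑ j, ((q : ℤ) ^ vs j - ((B j).ncard : ℤ)) →
      ∃ g ∈ FatInterpolation.solutionSet hf x A B vs, g ≠ 0) := by
  subst hq
  have : Finite (IsLocalRing.ResidueField R) :=
    Finite.of_surjective _ (IsLocalRing.residue_surjective (R := R))
  have hbound : (FatInterpolation.solutionSet hf x A B vs).ncard ≠ 0 →
      FatInterpolation.minProd (fun i => (A i).ncard) (∑ i, ((A i).ncard : ℤ) -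
        ∑ j, ((Nat.card (IsLocalRing.ResidueField R) : ℤ) ^ vs j - ((B j).ncard : ℤ))) ≤
          (FatInterpolation.solutionSet hf x A B vs).ncard := by
    rw [FatInterpolation.ncard_solutionSet]
    intro h
    obtain ⟨c₀, hc₀⟩ := Set.nonempty_of_ncard_ne_zero h
    exact FatInterpolation.minProd_le_ncard_of_mem hv
      (fun j i => MvPolynomial.eval (x j) (f i)) A hA B hB vs hvs hc₀
  refine ⟨or_iff_not_imp_left.2 hbound, fun hA0 hB0 hM => ?_⟩
  -- Zero being a solution excludes the empty case; a bound exceeding `1` then yields a second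
  -- solution.
  have hzero : 0 ∈ FatInterpolation.solutionSet hf x A B vs :=
    ⟨fun i => by simpa using hA0 i, fun j => ⟨0, hB0 j, by simp⟩⟩
  have hfin : (FatInterpolation.solutionSet hf x A B vs).Finite :=
    have := Finite.of_equiv _
      (Finsupp.equivFunOnFinite.symm.trans hf.linearCombinationEquiv.toEquiv)
    Set.toFinite _
  have hlt := (FatInterpolation.one_lt_minProd
    (fun i => (Set.ncard_pos (hA i).finite).2 (hA i).nonempty) hM (by
      rw [sub_le_self_iff]
      refine Finset.sum_nonneg fun j _ => sub_nonneg.2 ?_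
      exact_mod_cast (hB j).ncard_le_pow (hvs j).1)).trans_le (hbound (Set.ncard_ne_zero_of_mem hzero hfin))
  exact Set.exists_ne_of_one_lt_ncard hlt 0
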